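/- Let $m,s\ge 1$, let $\lambda_i,\mu_i>0$ and $\rho_i=\lambda_i/\mu_i$ $(1\le i\le m)$, $\mu_{\min}=\min_i\mu_i$, $\mu_{\max}=\max_i\mu_i$. Let $\mathbf D\in\mathbf R^{s\times m}$ have rows $\mathbf d_j$, let $\mathbf h\in\mathbf R_+^s$, and let $D^+_{ji}=\max\{D_{ji},0\}$, $D^-_{ji}=\max\{-D_{ji},0\}$ be the entries of $\mathbf D^{\pm}$, with rows $\mathbf d_j^{\pm}$. Let the target set be $\mathcal S=\{\mathbf x:\mathbf 0\le\mathbf x\le\boldsymbol\rho,\ \mathbf D\mathbf x\le\mathbf h\}$ and assume that some $\mathbf x\in\mathcal S$ satisfies $\mathbf D\mathbf x<\mathbf h$ (strictly in every row). Put $H_j=h_j+\mathbf d_j^-\boldsymbol\rho$, $$\tilde{\mathcal S}=\{(\mathbf x,\mathbf y):\mathbf 0\le\mathbf x\le\boldsymbol\rho,\ \mathbf 0\le\mathbf y\le\boldsymbol\rho,\ \mathbf x+\mathbf y\ge\boldsymbol\rho,\ \mathbf D^+\mathbf x+\mathbf D^-\mathbf y\le\mathbf h+\mathbf D^-\boldsymbol\rho\},$$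 let $(\mathbf x^*,\mathbf y^*)$ be any minimizer over $\tilde{\mathcal S}$ of $\max_{1\le j\le s}(\mathbf d_j^+\mathbf x+\mathbf d_j^-\mathbf y)/H_j$, and let $\gamma^*$ be the minimum value. For $\beta>0$ and $0<\varepsilon<\frac14$ let $$\Psi(\mathbf x,\mathbf y)=\sum_{j=1}^s\exp\Bigl(\beta\,\frac{\mathbf d_j^+\mathbf x+\mathbf d_j^-\mathbf y}{H_j}\Bigr),\qquad \Psi^*=\Psi\Bigl(\frac{(1+3\varepsilon)\mu_{\max}}{\mu_{\min}}(\mathbf x^*,\mathbf y^*)\Bigr).$$ Class $i$ requests arrive in independent Poisson streams of rates $\lambda_i$ and need independent $\exp(\mu_i)$ service times. The penalty policy accepts a class $i$ request arriving in state $(\mathbf x,\mathbf y)$ into the original infinite-capacity system if $\partial\Psi/\partial x_i\le\partial\Psi/\partial y_i$ at $(\mathbf x,\mathbf y)$, and otherwise routes it to a fictitious infinite-capacity system, where it stays for an independent $\exp(\mu_i)$ time. Let $\tilde{\mathbf x}(t),\tilde{\mathbf y}(t)\in\mathbf Z_+^m$ be the numbers of requests in the two systems at time $t$; initially the original system is empty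 and the fictitious system holds $\tilde{\mathbf y}(0^-)\in\mathbf Z_+^m$ requests. Suppose that $\beta\,|D_{ji}|\le\varepsilon H_j$ for all $i,j$ (if all $|D_{ji}|\le1$, this follows from $\beta\le\varepsilon\min_jH_j$), that $\mu_{\min}/\mu_{\max}\ge\gamma^*$, and that $\Psi(\mathbf 0,\tilde{\mathbf y}(0^-))\le\Psi^*$. Then, for all $t\ge0$, $\mathbf E[\tilde{\mathbf x}(t)]$ is finite and $$\mathbf d_j\,\mathbf E[\tilde{\mathbf x}(t)]\le h_j+\zeta\,(h_j+\mathbf d_j^-\boldsymbol\rho)+\mathbf d_j^-e^{-\mathbf Mt}(\boldsymbol\rho-\tilde{\mathbf y}(0^-)),\qquad j=1,\dots,s,$$ where $\zeta=\frac{\log s}{\beta}+3\varepsilon$ and $\mathbf M=\mathrm{diag}(\mu_1,\dots,\mu_m)$. -/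

import Mathlib

open MeasureTheory ProbabilityTheory Filter Topology
open scoped NNReal

noncomputable section

namespace PolytopicTarget

/-- Data of the state control problem with `m` request classes and `s` linear constraints:
Poisson arrival rates `lam`, exponential service rates `mu`, and the target constraints
`D x ≤ h`. -/
structure Model (m s : ℕ) where
  lam : Fin m → ℝ
  mu : Fin m → ℝ
  D : Matrix (Fin s) (Fin m) ℝ
  h : Fin s → ℝ

variable {m s : ℕ}

/-- The load `ρ_i = λ_i / μ_i` of class `i`. -/
def Model.load (M : Model m s) (i : Fin m) : ℝ := M.lam i / M.mu i

/-- The positive part `D⁺`. -/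
def Model.Dpos (M : Model m s) (j : Fin s) (i : Fin m) : ℝ := max (M.D j i) 0

/-- The negative part `D⁻`. -/
def Model.Dneg (M : Model m s) (j : Fin s) (i : Fin m) : ℝ := max (-(M.D j i)) 0

/-- The normalizing constant `h_j + d_j⁻ ρ` of constraint `j`. -/
def Model.cap (M : Model m s) (j : Fin s) : ℝ := M.h j + ∑ i, M.Dneg j i * M.load i

/-- The smallest service rate. -/
def Model.muMin (M : Model m s) : ℝ := ⨅ i, M.mu i

/-- The largest service rate. -/
def Model.muMax (M : Model m s) : ℝ := ⨆ i, M.mu i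

/-- The target polytope `{x : 0 ≤ x ≤ ρ, D x ≤ h}`. -/
def Model.targetSet (M : Model m s) : Set (Fin m → ℝ) :=
  {x | (∀ i, 0 ≤ x i ∧ x i ≤ M.load i) ∧ ∀ j, ∑ i, M.D j i * x i ≤ M.h j}

/-- The lifted set of pairs `(x, y)`. The constraint `ρ ≤ x + y` says that the pair accounts for
the whole load; without it the origin would be a member. Every pair `(x, ρ - x)` with `x` in the
target polytope belongs to the lifted set. -/
def Model.liftedSet (M : Model m s) : Set ((Fin m → ℝ) × (Fin m → ℝ)) :=
  {p | (∀ i, 0 ≤ p.1 i ∧ p.1 i ≤ M.load i) ∧ (∀ i, 0 ≤ p.2 i ∧ p.2 i ≤ M.load i) ∧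
    (∀ i, M.load i ≤ p.1 i + p.2 i) ∧
    ∀ j, ∑ i, M.Dpos j i * p.1 i + ∑ i, M.Dneg j i * p.2 i ≤ M.cap j}

/-- The ratio `(d_j⁺ x + d_j⁻ y) / (h_j + d_j⁻ ρ)`. -/
def Model.ratio (M : Model m s) (j : Fin s) (x y : Fin m → ℝ) : ℝ :=
  (∑ i, M.Dpos j i * x i + ∑ i, M.Dneg j i * y i) / M.cap j

/-- The largest ratio over all constraints. -/
def Model.violation (M : Model m s) (p : (Fin m → ℝ) × (Fin m → ℝ)) : ℝ :=
  ⨆ j, M.ratio j p.1 p.2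

/-- The exponential penalty function `Ψ(x, y)` with multiplier `β`. -/
def Model.penalty (M : Model m s) (β : ℝ) (x y : Fin m → ℝ) : ℝ :=
  ∑ j, Real.exp (β * M.ratio j x y)

/-- `Ψ* = Ψ((1 + 3ε) (μ_max / μ_min) (x*, y*))`. -/
def Model.penaltyLevel (M : Model m s) (β ε : ℝ) (p : (Fin m → ℝ) × (Fin m → ℝ)) : ℝ :=
  M.penalty β (((1 + 3 * ε) * M.muMax / M.muMin) • p.1) (((1 + 3 * ε) * M.muMax / M.muMin) • p.2)

/-- The partial derivative `∂Ψ/∂x_i` at `(x, y)`. -/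
def Model.partialX (M : Model m s) (β : ℝ) (i : Fin m) (x y : Fin m → ℝ) : ℝ :=
  deriv (fun u : ℝ => M.penalty β (Function.update x i u) y) (x i)

/-- The partial derivative `∂Ψ/∂y_i` at `(x, y)`. -/
def Model.partialY (M : Model m s) (β : ℝ) (i : Fin m) (x y : Fin m → ℝ) : ℝ :=
  deriv (fun u : ℝ => M.penalty β x (Function.update y i u)) (y i)

/-- States: numbers of class `i` requests in the original and in the fictitious system. -/
abbrev State (m : ℕ) : Type := (Fin m → ℕ) × (Fin m → ℕ)

/-- The penalty policy accepts an arriving class `i` request in state `z`. -/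
def Model.Accepts (M : Model m s) (β : ℝ) (i : Fin m) (z : State m) : Prop :=
  M.partialX β i (fun k => (z.1 k : ℝ)) (fun k => (z.2 k : ℝ)) ≤
    M.partialY β i (fun k => (z.1 k : ℝ)) (fun k => (z.2 k : ℝ))

open Classical in
/-- The state after a class `i` arrival: the request joins the original system if it is accepted
and the fictitious system otherwise. -/
def Model.arrive (M : Model m s) (β : ℝ) (i : Fin m) (z : State m) : State m :=
  if M.Accepts β i z then (Function.update z.1 i (z.1 i + 1), z.2)
  else (z.1, Function.update z.2 i (z.2 i + 1))

/-- The state after a class `i` departure from the original system. -/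
def departX (i : Fin m) (z : State m) : State m := (Function.update z.1 i (z.1 i - 1), z.2)

/-- The state after a class `i` departure from the fictitious system. -/
def departY (i : Fin m) (z : State m) : State m := (z.1, Function.update z.2 i (z.2 i - 1))

/-- The generator of the controlled Markov process: class `i` requests arrive at rate `λ_i` and
are routed by the penalty policy; every class `i` request present in either system departs at
rate `μ_i`. -/
def Model.generator (M : Model m s) (β : ℝ) (f : State m → ℝ) (z : State m) : ℝ :=
  ∑ i, (M.lam i * (f (M.arrive β i z) - f z)
    + M.mu i * (z.1 i : ℝ) * (f (departX i z) - f z)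
    + M.mu i * (z.2 i : ℝ) * (f (departY i z) - f z))

/-- `X` is the state process of the penalty policy, started with the original system empty and
with load `y₀` in the fictitious system: an adapted process with values in the (discrete) state
space and with right-continuous paths with left limits, which solves the martingale problem of
the generator for all finitely supported test functions. -/
structure IsPenaltyProcess (M : Model m s) (β : ℝ) (y₀ : Fin m → ℕ)
    {Ω : Type*} [mΩ : MeasurableSpace Ω] (P : Measure Ω) (ℱ : Filtration ℝ≥0 mΩ)
    (X : ℝ≥0 → Ω → State m) : Prop where
  adapted : ∀ t, Measurable[ℱ t] (X t)
  right_continuous : ∀ ω t, ∀ᶠ u in 𝓝[≥] t, X u ω = X t ω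
  left_limits : ∀ ω t, ∃ z, ∀ᶠ u in 𝓝[<] t, X u ω = z
  initial : ∀ᵐ ω ∂P, X 0 ω = (0, y₀)
  martingale : ∀ f : State m → ℝ, (Function.support f).Finite →
    Martingale (fun (t : ℝ≥0) ω => f (X t ω)
      - ∫ u in (0 : ℝ)..(t : ℝ), M.generator β f (X u.toNNReal ω)) ℱ P

end PolytopicTarget

end

namespace PolytopicTarget

variable {m s : ℕ}

/-! The penalty `Ψ` is a Lyapunov function. With `a`, `b` the partial derivatives of `Ψ` in `x_i`,
`y_i`, the policy sends a class `i` arrival where the derivative is smaller, so arrivals raise `Ψ`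
at rate at most `(1 + ε) λ_i min a b`. Since `λ_i = μ_i ρ_i` and `ρ_i ≤ x*_i + y*_i`, this is at
most `(1 + ε) μ_max (x*_i a + y*_i b)`. Departures lower `Ψ` at rate at least `(1 - ε) μ_i (x_i a +
y_i b)`. Convexity of `Ψ` turns the difference into the drift bound `(1 - ε) μ_min (Ψ* - Ψ)`
(`generator_statePenalty_le`), so the mean of `Ψ`, started below `Ψ*`, stays below it
(`integral_le_of_generator_le`).

The condition on the service rates gives `Ψ* ≤ s exp (β (1 + 3ε))` (`penaltyLevel_le`), and Jensen's
inequality then yields `d_j⁺ E x + d_j⁻ E y ≤ (1 + ζ) H_j` (`integral_ratio_le`). Routing does not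
affect `x + y`, whose coordinates are infinite-server queues with explicit means. Substituting this
for `E y` leaves the bound on `d_j E x`.

The martingale problem only covers finitely supported functions, while `Ψ` grows exponentially.
Exponential moments of the number of requests, obtained from truncated exponentials by Fatou's lemma
(`exists_integral_pow_le`), extend Dynkin's formula to every function of exponential growth
(`integral_eq_of_expGrowth`). -/

/-- The total number of requests in a state. -/
def size (z : State m) : ℕ := ∑ i, (z.1 i + z.2 i)

/-- The penalty of a state. -/
noncomputable def Model.statePenalty (M : Model m s) (β : ℝ) (z : State m) : ℝ :=
  M.penalty β (fun k => (z.1 k : ℝ)) (fun k => (z.2 k : ℝ))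

/-- The number of class `i` requests in both systems. -/
def classCount (i : Fin m) (z : State m) : ℝ := (z.1 i : ℝ) + (z.2 i : ℝ)

/-! ### Counting requests -/

lemma sum_update_nat (x : Fin m → ℕ) (i : Fin m) (v : ℕ) :
    ∑ k, Function.update x i v k + x i = ∑ k, x k + v := by
  rw [Finset.sum_update_of_mem (Finset.mem_univ i),
    ← Finset.add_sum_erase Finset.univ x (Finset.mem_univ i), Finset.sdiff_singleton_eq_erase]
  omega

lemma size_eq (z : State m) : size z = ∑ i, z.1 i + ∑ i, z.2 i := Finset.sum_add_distrib

lemma size_arrive (M : Model m s) (β : ℝ) (i : Fin m) (z : State m) :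
    size (M.arrive β i z) = size z + 1 := by
  unfold Model.arrive
  split_ifs
  · have := sum_update_nat z.1 i (z.1 i + 1)
    simp only [size_eq]; omega
  · have := sum_update_nat z.2 i (z.2 i + 1)
    simp only [size_eq]; omega

lemma size_departX_of_pos {i : Fin m} {z : State m} (h : 0 < z.1 i) :
    size (departX i z) + 1 = size z := by
  have := sum_update_nat z.1 i (z.1 i - 1)
  simp only [size_eq, departX]; omega

lemma size_departY_of_pos {i : Fin m} {z : State m} (h : 0 < z.2 i) :
    size (departY i z) + 1 = size z := by
  have := sum_update_nat z.2 i (z.2 i - 1)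
  simp only [size_eq, departY]; omega

lemma size_departX_le (i : Fin m) (z : State m) : size (departX i z) ≤ size z := by
  have := sum_update_nat z.1 i (z.1 i - 1)
  simp only [size_eq, departX]; omega

lemma size_departY_le (i : Fin m) (z : State m) : size (departY i z) ≤ size z := by
  have := sum_update_nat z.2 i (z.2 i - 1)
  simp only [size_eq, departY]; omega

lemma classCount_le_size (i : Fin m) (z : State m) : classCount i z ≤ size z := by
  unfold classCount size
  exact_mod_cast Finset.single_le_sum (f := fun k => z.1 k + z.2 k) (fun _ _ => Nat.zero_le _)
    (Finset.mem_univ i)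

lemma finite_size_lt (N : ℕ) : {z : State m | size z < N}.Finite := by
  refine ((Set.finite_Icc (0 : Fin m → ℕ) fun _ => N).prod
    (Set.finite_Icc (0 : Fin m → ℕ) fun _ => N)).subset fun z hz => ?_
  have hz : size z < N := hz
  have key : ∀ i, z.1 i + z.2 i ≤ size z := fun i =>
    Finset.single_le_sum (f := fun k => z.1 k + z.2 k) (fun _ _ => Nat.zero_le _)
      (Finset.mem_univ i)
  refine ⟨⟨fun _ => Nat.zero_le _, fun i => ?_⟩, ⟨fun _ => Nat.zero_le _, fun i => ?_⟩⟩
  · have := key i; show z.1 i ≤ N; omega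
  · have := key i; show z.2 i ≤ N; omega

section rates

variable (M : Model m s)

lemma Model.muMin_le (i : Fin m) : M.muMin ≤ M.mu i :=
  ciInf_le (Set.finite_range _).bddBelow i

lemma Model.le_muMax (i : Fin m) : M.mu i ≤ M.muMax :=
  le_ciSup (Set.finite_range _).bddAbove i

lemma Model.muMin_pos [NeZero m] (hmu : ∀ i, 0 < M.mu i) : 0 < M.muMin := by
  obtain ⟨i, hi⟩ := exists_eq_ciInf_of_finite (f := M.mu)
  unfold Model.muMin
  rw [← hi]; exact hmu i

end rates

/-! ### Derivatives, unit increments and convexity of the penalty -/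

section penalty

variable (M : Model m s) (β : ℝ)

lemma cast_update (x : Fin m → ℕ) (i : Fin m) (v : ℕ) :
    (fun k => ((Function.update x i v k : ℕ) : ℝ)) =
      Function.update (fun k => (x k : ℝ)) i (v : ℝ) := by
  ext k
  by_cases h : k = i
  · subst h; simp
  · simp [h]

lemma sum_mul_update (c x : Fin m → ℝ) (i : Fin m) (u : ℝ) :
    ∑ k, c k * Function.update x i u k = ∑ k, c k * x k + c i * (u - x i) := by
  have h : ∀ k, c k * Function.update x i u k = c k * x k + if k = i then c i * (u - x i) else 0 := by
    intro k
    by_cases hk : k = i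
    · subst hk; simp; ring
    · simp [hk]
  simp [h, Finset.sum_add_distrib]

lemma Model.ratio_update_left (j : Fin s) (i : Fin m) (x y : Fin m → ℝ) (u : ℝ) :
    M.ratio j (Function.update x i u) y = M.ratio j x y + M.Dpos j i / M.cap j * (u - x i) := by
  unfold Model.ratio
  rw [sum_mul_update]; ring

lemma Model.ratio_update_right (j : Fin s) (i : Fin m) (x y : Fin m → ℝ) (u : ℝ) :
    M.ratio j x (Function.update y i u) = M.ratio j x y + M.Dneg j i / M.cap j * (u - y i) := by
  unfold Model.ratio
  rw [sum_mul_update]; ring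

lemma Model.partialX_eq (i : Fin m) (x y : Fin m → ℝ) :
    M.partialX β i x y =
      ∑ j, Real.exp (β * M.ratio j x y) * (β * (M.Dpos j i / M.cap j)) := by
  unfold Model.partialX Model.penalty
  simp only [Model.ratio_update_left]
  refine HasDerivAt.deriv ?_
  refine HasDerivAt.fun_sum fun j _ => ?_
  have h := ((((hasDerivAt_id (x i)).sub_const (x i)).const_mul (M.Dpos j i / M.cap j)).const_add
    (M.ratio j x y)).const_mul β
  simpa using h.exp

lemma Model.partialY_eq (i : Fin m) (x y : Fin m → ℝ) :
    M.partialY β i x y =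
      ∑ j, Real.exp (β * M.ratio j x y) * (β * (M.Dneg j i / M.cap j)) := by
  unfold Model.partialY Model.penalty
  simp only [Model.ratio_update_right]
  refine HasDerivAt.deriv ?_
  refine HasDerivAt.fun_sum fun j _ => ?_
  have h := ((((hasDerivAt_id (y i)).sub_const (y i)).const_mul (M.Dneg j i / M.cap j)).const_add
    (M.ratio j x y)).const_mul β
  simpa using h.exp

/-- The Taylor remainder is at most `u ^ 2 ≤ ε * u`. This and the next bound replace unit increments
of `Ψ` by partial derivatives, at the cost of factors `1 + ε` and `1 - ε`. -/
lemma exp_sub_one_le {ε u : ℝ} (hε : ε ≤ 1) (h0 : 0 ≤ u) (hu : u ≤ ε) :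
    Real.exp u - 1 ≤ (1 + ε) * u := by
  have h := Real.abs_exp_sub_one_sub_id_le (x := u) (by rw [abs_of_nonneg h0]; linarith)
  have := (abs_le.1 h).2
  nlinarith

lemma exp_neg_sub_one_le {ε u : ℝ} (hε : ε ≤ 1) (h0 : 0 ≤ u) (hu : u ≤ ε) :
    Real.exp (-u) - 1 ≤ -((1 - ε) * u) := by
  have h := Real.abs_exp_sub_one_sub_id_le (x := -u) (by rw [abs_neg, abs_of_nonneg h0]; linarith)
  have := (abs_le.1 h).2
  nlinarith

lemma Model.Dpos_nonneg (j : Fin s) (i : Fin m) : 0 ≤ M.Dpos j i := le_max_right _ _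

lemma Model.Dneg_nonneg (j : Fin s) (i : Fin m) : 0 ≤ M.Dneg j i := le_max_right _ _

lemma Model.Dpos_sub_Dneg (j : Fin s) (i : Fin m) : M.Dpos j i - M.Dneg j i = M.D j i := by
  unfold Model.Dpos Model.Dneg
  rcases le_total (M.D j i) 0 with h | h
  · rw [max_eq_right h, max_eq_left (by linarith)]; ring
  · rw [max_eq_left h, max_eq_right (by linarith)]; ring

lemma Model.Dpos_le_abs (j : Fin s) (i : Fin m) : M.Dpos j i ≤ |M.D j i| :=
  max_le (le_abs_self _) (abs_nonneg _)

lemma Model.Dneg_le_abs (j : Fin s) (i : Fin m) : M.Dneg j i ≤ |M.D j i| :=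
  max_le (neg_le_abs _) (abs_nonneg _)

/-- At a strictly feasible `x`, `H_j` exceeds `d_j x + d_j⁻ ρ = d_j⁺ x + d_j⁻ (ρ - x)`, which is
nonnegative. -/
lemma Model.cap_pos (hint : ∃ x ∈ M.targetSet, ∀ j, ∑ i, M.D j i * x i < M.h j) (j : Fin s) :
    0 < M.cap j := by
  obtain ⟨x, ⟨hx, -⟩, hlt⟩ := hint
  have h1 := hlt j
  have h2 : 0 ≤ ∑ i, (M.Dpos j i * x i + M.Dneg j i * (M.load i - x i)) :=
    Finset.sum_nonneg fun i _ => add_nonneg (mul_nonneg (M.Dpos_nonneg j i) (hx i).1)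
      (mul_nonneg (M.Dneg_nonneg j i) (by linarith [(hx i).2]))
  have h3 : ∑ i, (M.Dpos j i * x i + M.Dneg j i * (M.load i - x i)) =
      ∑ i, M.D j i * x i + ∑ i, M.Dneg j i * M.load i := by
    rw [← Finset.sum_add_distrib]
    refine Finset.sum_congr rfl fun i _ => ?_
    rw [← M.Dpos_sub_Dneg j i]; ring
  unfold Model.cap
  linarith

lemma mul_div_le_of_abs_le {β ε a d c : ℝ} (hβ : 0 < β) (hc : 0 < c) (had : a ≤ |d|)
    (h : β * |d| ≤ ε * c) : β * (a / c) ≤ ε := by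
  rw [← mul_div_assoc, div_le_iff₀ hc]
  exact (mul_le_mul_of_nonneg_left had hβ.le).trans h

/-- Upper bound on the penalty after adding one request to the original system. -/
lemma Model.penalty_add_left_le {ε : ℝ} (hβ₀ : 0 < β) (hε : ε ≤ 1) (hcap : ∀ j, 0 < M.cap j)
    (hβ : ∀ j i, β * |M.D j i| ≤ ε * M.cap j) (i : Fin m) (x y : Fin m → ℝ) :
    M.penalty β (Function.update x i (x i + 1)) y - M.penalty β x y ≤
      (1 + ε) * M.partialX β i x y := by
  rw [M.partialX_eq]
  unfold Model.penalty
  rw [← Finset.sum_sub_distrib, Finset.mul_sum]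
  refine Finset.sum_le_sum fun j _ => ?_
  rw [M.ratio_update_left, add_sub_cancel_left, mul_one, mul_add, Real.exp_add]
  have h := exp_sub_one_le hε
    (mul_nonneg hβ₀.le (div_nonneg (M.Dpos_nonneg j i) (hcap j).le))
    (mul_div_le_of_abs_le hβ₀ (hcap j) (M.Dpos_le_abs j i) (hβ j i))
  have := mul_le_mul_of_nonneg_left h (Real.exp_pos (β * M.ratio j x y)).le
  linarith

lemma Model.penalty_add_right_le {ε : ℝ} (hβ₀ : 0 < β) (hε : ε ≤ 1) (hcap : ∀ j, 0 < M.cap j)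
    (hβ : ∀ j i, β * |M.D j i| ≤ ε * M.cap j) (i : Fin m) (x y : Fin m → ℝ) :
    M.penalty β x (Function.update y i (y i + 1)) - M.penalty β x y ≤
      (1 + ε) * M.partialY β i x y := by
  rw [M.partialY_eq]
  unfold Model.penalty
  rw [← Finset.sum_sub_distrib, Finset.mul_sum]
  refine Finset.sum_le_sum fun j _ => ?_
  rw [M.ratio_update_right, add_sub_cancel_left, mul_one, mul_add, Real.exp_add]
  have h := exp_sub_one_le hε
    (mul_nonneg hβ₀.le (div_nonneg (M.Dneg_nonneg j i) (hcap j).le))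
    (mul_div_le_of_abs_le hβ₀ (hcap j) (M.Dneg_le_abs j i) (hβ j i))
  have := mul_le_mul_of_nonneg_left h (Real.exp_pos (β * M.ratio j x y)).le
  linarith

/-- Upper bound on the penalty after removing one request from the original system. -/
lemma Model.penalty_sub_left_le {ε : ℝ} (hβ₀ : 0 < β) (hε : ε ≤ 1) (hcap : ∀ j, 0 < M.cap j)
    (hβ : ∀ j i, β * |M.D j i| ≤ ε * M.cap j) (i : Fin m) (x y : Fin m → ℝ) :
    M.penalty β (Function.update x i (x i - 1)) y - M.penalty β x y ≤
      -((1 - ε) * M.partialX β i x y) := by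
  rw [M.partialX_eq]
  unfold Model.penalty
  rw [← Finset.sum_sub_distrib, Finset.mul_sum, ← Finset.sum_neg_distrib]
  refine Finset.sum_le_sum fun j _ => ?_
  rw [M.ratio_update_left, sub_sub_cancel_left, mul_neg_one, mul_add, Real.exp_add, mul_neg]
  have h := exp_neg_sub_one_le hε
    (mul_nonneg hβ₀.le (div_nonneg (M.Dpos_nonneg j i) (hcap j).le))
    (mul_div_le_of_abs_le hβ₀ (hcap j) (M.Dpos_le_abs j i) (hβ j i))
  have := mul_le_mul_of_nonneg_left h (Real.exp_pos (β * M.ratio j x y)).le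
  linarith

lemma Model.penalty_sub_right_le {ε : ℝ} (hβ₀ : 0 < β) (hε : ε ≤ 1) (hcap : ∀ j, 0 < M.cap j)
    (hβ : ∀ j i, β * |M.D j i| ≤ ε * M.cap j) (i : Fin m) (x y : Fin m → ℝ) :
    M.penalty β x (Function.update y i (y i - 1)) - M.penalty β x y ≤
      -((1 - ε) * M.partialY β i x y) := by
  rw [M.partialY_eq]
  unfold Model.penalty
  rw [← Finset.sum_sub_distrib, Finset.mul_sum, ← Finset.sum_neg_distrib]
  refine Finset.sum_le_sum fun j _ => ?_
  rw [M.ratio_update_right, sub_sub_cancel_left, mul_neg_one, mul_add, Real.exp_add, mul_neg]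
  have h := exp_neg_sub_one_le hε
    (mul_nonneg hβ₀.le (div_nonneg (M.Dneg_nonneg j i) (hcap j).le))
    (mul_div_le_of_abs_le hβ₀ (hcap j) (M.Dneg_le_abs j i) (hβ j i))
  have := mul_le_mul_of_nonneg_left h (Real.exp_pos (β * M.ratio j x y)).le
  linarith

lemma Model.partialX_nonneg (hβ₀ : 0 < β) (hcap : ∀ j, 0 < M.cap j) (i : Fin m)
    (x y : Fin m → ℝ) : 0 ≤ M.partialX β i x y := by
  rw [M.partialX_eq]
  exact Finset.sum_nonneg fun j _ => mul_nonneg (Real.exp_pos _).le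
    (mul_nonneg hβ₀.le (div_nonneg (M.Dpos_nonneg j i) (hcap j).le))

lemma Model.partialY_nonneg (hβ₀ : 0 < β) (hcap : ∀ j, 0 < M.cap j) (i : Fin m)
    (x y : Fin m → ℝ) : 0 ≤ M.partialY β i x y := by
  rw [M.partialY_eq]
  exact Finset.sum_nonneg fun j _ => mul_nonneg (Real.exp_pos _).le
    (mul_nonneg hβ₀.le (div_nonneg (M.Dneg_nonneg j i) (hcap j).le))

/-- The gradient inequality for the convex penalty function. -/
lemma Model.penalty_gradient_le (x y x' y' : Fin m → ℝ) :
    ∑ i, (M.partialX β i x y * (x' i - x i) + M.partialY β i x y * (y' i - y i)) ≤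
      M.penalty β x' y' - M.penalty β x y := by
  -- Each ratio is linear in `(x, y)`, so row by row the gradient pairing is `e^u (v - u)`, with
  -- `u`, `v` the old and new exponents.
  have h : ∀ j, ∑ i, (Real.exp (β * M.ratio j x y) * (β * (M.Dpos j i / M.cap j)) * (x' i - x i)
      + Real.exp (β * M.ratio j x y) * (β * (M.Dneg j i / M.cap j)) * (y' i - y i)) =
      Real.exp (β * M.ratio j x y) * (β * M.ratio j x' y' - β * M.ratio j x y) := by
    intro j
    generalize Real.exp (β * M.ratio j x y) = w
    unfold Model.ratio
    rw [← Finset.sum_add_distrib, ← Finset.sum_add_distrib, ← mul_sub, ← sub_div,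
      ← Finset.sum_sub_distrib, Finset.sum_div, Finset.mul_sum, Finset.mul_sum]
    refine Finset.sum_congr rfl fun i _ => ?_
    ring
  simp only [M.partialX_eq, M.partialY_eq, Finset.sum_mul, ← Finset.sum_add_distrib]
  rw [Finset.sum_comm]
  simp only [h]
  unfold Model.penalty
  rw [← Finset.sum_sub_distrib]
  refine Finset.sum_le_sum fun j _ => ?_
  -- Tangent line of the exponential: `e^u (1 + v - u) ≤ e^v`.
  have h1 := Real.add_one_le_exp (β * M.ratio j x' y' - β * M.ratio j x y)
  rw [Real.exp_sub, le_div_iff₀ (Real.exp_pos _)] at h1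
  linarith

end penalty

/-! ### Drift estimates for the generator -/

section drift

variable (M : Model m s) (β : ℝ)

/-- In either branch the policy moves along the coordinate with the smaller derivative. -/
lemma Model.statePenalty_arrive_le {ε : ℝ} (hβ₀ : 0 < β) (hε : ε ≤ 1)
    (hcap : ∀ j, 0 < M.cap j)
    (hβ : ∀ j i, β * |M.D j i| ≤ ε * M.cap j) (i : Fin m) (z : State m) :
    M.statePenalty β (M.arrive β i z) - M.statePenalty β z ≤
      (1 + ε) * min (M.partialX β i (fun k => (z.1 k : ℝ)) (fun k => (z.2 k : ℝ)))
        (M.partialY β i (fun k => (z.1 k : ℝ)) (fun k => (z.2 k : ℝ))) := by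
  unfold Model.arrive
  split_ifs with h
  · have h' := h
    unfold Model.Accepts at h'
    rw [min_eq_left h']
    simp only [Model.statePenalty, cast_update]
    push_cast
    exact M.penalty_add_left_le β hβ₀ hε hcap hβ i _ _
  · have h' := h
    unfold Model.Accepts at h'
    rw [min_eq_right (not_le.1 h').le]
    simp only [Model.statePenalty, cast_update]
    push_cast
    exact M.penalty_add_right_le β hβ₀ hε hcap hβ i _ _

lemma Model.statePenalty_departX_le {ε : ℝ} (hβ₀ : 0 < β) (hε : ε ≤ 1) (hcap : ∀ j, 0 < M.cap j)
    (hβ : ∀ j i, β * |M.D j i| ≤ ε * M.cap j) (i : Fin m) (z : State m) :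
    (z.1 i : ℝ) * (M.statePenalty β (departX i z) - M.statePenalty β z) ≤
      (z.1 i : ℝ) * -((1 - ε) * M.partialX β i (fun k => (z.1 k : ℝ)) (fun k => (z.2 k : ℝ))) := by
  -- With no request present the truncated subtraction leaves the state unchanged, but the departure
  -- rate vanishes.
  rcases Nat.eq_zero_or_pos (z.1 i) with h | h
  · simp [h]
  · refine mul_le_mul_of_nonneg_left ?_ (Nat.cast_nonneg _)
    simp only [Model.statePenalty, departX, cast_update]
    push_cast [Nat.cast_sub (Nat.succ_le_of_lt h)]
    exact M.penalty_sub_left_le β hβ₀ hε hcap hβ i _ _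

lemma Model.statePenalty_departY_le {ε : ℝ} (hβ₀ : 0 < β) (hε : ε ≤ 1) (hcap : ∀ j, 0 < M.cap j)
    (hβ : ∀ j i, β * |M.D j i| ≤ ε * M.cap j) (i : Fin m) (z : State m) :
    (z.2 i : ℝ) * (M.statePenalty β (departY i z) - M.statePenalty β z) ≤
      (z.2 i : ℝ) * -((1 - ε) * M.partialY β i (fun k => (z.1 k : ℝ)) (fun k => (z.2 k : ℝ))) := by
  rcases Nat.eq_zero_or_pos (z.2 i) with h | h
  · simp [h]
  · refine mul_le_mul_of_nonneg_left ?_ (Nat.cast_nonneg _)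
    simp only [Model.statePenalty, departY, cast_update]
    push_cast [Nat.cast_sub (Nat.succ_le_of_lt h)]
    exact M.penalty_sub_right_le β hβ₀ hε hcap hβ i _ _

/-- The penalty function drifts towards the level `Ψ*`. -/
lemma Model.generator_statePenalty_le [NeZero m] {ε : ℝ}
    (hlam : ∀ i, 0 < M.lam i) (hmu : ∀ i, 0 < M.mu i)
    (hβ₀ : 0 < β) (hε₀ : 0 < ε) (hε : ε < 1 / 4)
    (hcap : ∀ j, 0 < M.cap j) (hβ : ∀ j i, β * |M.D j i| ≤ ε * M.cap j)
    {p : (Fin m → ℝ) × (Fin m → ℝ)} (hp : p ∈ M.liftedSet) (z : State m) :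
    M.generator β (M.statePenalty β) z ≤
      (1 - ε) * M.muMin * (M.penaltyLevel β ε p - M.statePenalty β z) := by
  have hmin := M.muMin_pos hmu
  obtain ⟨hp1, hp2, hp3, -⟩ := hp
  set x : Fin m → ℝ := fun k => (z.1 k : ℝ)
  set y : Fin m → ℝ := fun k => (z.2 k : ℝ)
  set c : ℝ := (1 + 3 * ε) * M.muMax / M.muMin
  have hgrad := M.penalty_gradient_le β x y (c • p.1) (c • p.2)
  refine le_trans ?_ (mul_le_mul_of_nonneg_left hgrad (by nlinarith : 0 ≤ (1 - ε) * M.muMin))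
  unfold Model.generator
  rw [Finset.mul_sum]
  refine Finset.sum_le_sum fun i _ => ?_
  have hA := mul_le_mul_of_nonneg_left
    (M.statePenalty_arrive_le β hβ₀ (by linarith) hcap hβ i z) (hlam i).le
  have hX := mul_le_mul_of_nonneg_left
    (M.statePenalty_departX_le β hβ₀ (by linarith) hcap hβ i z) (hmu i).le
  have hY := mul_le_mul_of_nonneg_left
    (M.statePenalty_departY_le β hβ₀ (by linarith) hcap hβ i z) (hmu i).le
  have hdx : 0 ≤ M.partialX β i x y := M.partialX_nonneg β hβ₀ hcap i x y
  have hdy : 0 ≤ M.partialY β i x y := M.partialY_nonneg β hβ₀ hcap i x y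
  set a := M.partialX β i x y
  set b := M.partialY β i x y
  have hx0 : 0 ≤ x i := Nat.cast_nonneg _
  have hy0 : 0 ≤ y i := Nat.cast_nonneg _
  change M.lam i * _ ≤ M.lam i * ((1 + ε) * min a b) at hA
  change M.mu i * (x i * _) ≤ M.mu i * (x i * -((1 - ε) * a)) at hX
  change M.mu i * (y i * _) ≤ M.mu i * (y i * -((1 - ε) * b)) at hY
  change M.lam i * _ + M.mu i * x i * _ + M.mu i * y i * _ ≤
    (1 - ε) * M.muMin * (a * (c * p.1 i - x i) + b * (c * p.2 i - y i))
  have hload : M.lam i = M.mu i * M.load i := by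
    unfold Model.load; rw [mul_div_cancel₀ _ (hmu i).ne']
  have hmm : 0 ≤ min a b := le_min hdx hdy
  -- Here `ρ ≤ x* + y*` enters: greedy routing costs no more than splitting the load as `(x*, y*)`.
  have hsplit : M.load i * min a b ≤ p.1 i * a + p.2 i * b := by
    calc M.load i * min a b ≤ (p.1 i + p.2 i) * min a b :=
          mul_le_mul_of_nonneg_right (hp3 i) hmm
      _ ≤ p.1 i * a + p.2 i * b := by
          rw [add_mul]
          exact add_le_add (mul_le_mul_of_nonneg_left (min_le_left _ _) (hp1 i).1)
            (mul_le_mul_of_nonneg_left (min_le_right _ _) (hp2 i).1)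
  have hw0 : 0 ≤ p.1 i * a + p.2 i * b :=
    add_nonneg (mul_nonneg (hp1 i).1 hdx) (mul_nonneg (hp2 i).1 hdy)
  have hv0 : 0 ≤ x i * a + y i * b := add_nonneg (mul_nonneg hx0 hdx) (mul_nonneg hy0 hdy)
  have h1 : M.lam i * ((1 + ε) * min a b) ≤ (1 + ε) * M.muMax * (p.1 i * a + p.2 i * b) := by
    rw [hload]
    calc M.mu i * M.load i * ((1 + ε) * min a b)
        = (1 + ε) * M.mu i * (M.load i * min a b) := by ring
      _ ≤ (1 + ε) * M.mu i * (p.1 i * a + p.2 i * b) :=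
          mul_le_mul_of_nonneg_left hsplit (mul_nonneg (by linarith) (hmu i).le)
      _ ≤ _ := mul_le_mul_of_nonneg_right
          (mul_le_mul_of_nonneg_left (M.le_muMax i) (by linarith)) hw0
  -- The factor `1 + 3ε` in `Ψ*` is chosen so that `1 + ε ≤ (1 - ε) (1 + 3ε)`, which holds for `ε ≤
  -- 1/3`.
  have h2 : (1 + ε) * M.muMax * (p.1 i * a + p.2 i * b) ≤
      (1 - ε) * M.muMin * c * (p.1 i * a + p.2 i * b) := by
    refine mul_le_mul_of_nonneg_right ?_ hw0
    have : (1 - ε) * M.muMin * c = ((1 - ε) * (1 + 3 * ε)) * M.muMax := by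
      simp only [c]; field_simp
    rw [this]
    refine mul_le_mul_of_nonneg_right (by nlinarith) ((hmu i).le.trans (M.le_muMax i))
  have h3 : (1 - ε) * M.muMin * (x i * a + y i * b) ≤ (1 - ε) * M.mu i * (x i * a + y i * b) :=
    mul_le_mul_of_nonneg_right
      (mul_le_mul_of_nonneg_left (M.muMin_le i) (by linarith)) hv0
  linarith

/-- Both routing decisions add one request to the class total, so it evolves as an infinite-server
queue, whatever the policy. -/
lemma Model.generator_classCount (i : Fin m) (z : State m) :
    M.generator β (classCount i) z = M.lam i - M.mu i * classCount i z := by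
  unfold Model.generator
  rw [Finset.sum_eq_single i]
  · have hA : classCount i (M.arrive β i z) - classCount i z = 1 := by
      unfold Model.arrive classCount
      split_ifs <;> simp
    have hX : (z.1 i : ℝ) * (classCount i (departX i z) - classCount i z) = -(z.1 i : ℝ) := by
      rcases Nat.eq_zero_or_pos (z.1 i) with h | h
      · simp [h]
      · simp only [classCount, departX, Function.update_self]
        push_cast [Nat.cast_sub (Nat.succ_le_of_lt h)]
        ring
    have hY : (z.2 i : ℝ) * (classCount i (departY i z) - classCount i z) = -(z.2 i : ℝ) := by
      rcases Nat.eq_zero_or_pos (z.2 i) with h | h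
      · simp [h]
      · simp only [classCount, departY, Function.update_self]
        push_cast [Nat.cast_sub (Nat.succ_le_of_lt h)]
        ring
    rw [hA, mul_assoc, mul_assoc, hX, hY, classCount]
    ring
  · intro k _ hk
    have hA : classCount i (M.arrive β k z) = classCount i z := by
      unfold Model.arrive classCount
      split_ifs <;> simp [Function.update_of_ne hk.symm]
    have hX : classCount i (departX k z) = classCount i z := by
      simp [classCount, departX, Function.update_of_ne hk.symm]
    have hY : classCount i (departY k z) = classCount i z := by
      simp [classCount, departY, Function.update_of_ne hk.symm]
    rw [hA, hX, hY]; ring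
  · simp

/-- Every request adds at most `ε ≤ 1` to each exponent. -/
lemma Model.abs_statePenalty_le {ε : ℝ} (hβ₀ : 0 < β) (hε : ε ≤ 1) (hcap : ∀ j, 0 < M.cap j)
    (hβ : ∀ j i, β * |M.D j i| ≤ ε * M.cap j) (z : State m) :
    |M.statePenalty β z| ≤ s * Real.exp 1 ^ size z := by
  unfold Model.statePenalty Model.penalty
  rw [abs_of_nonneg (Finset.sum_nonneg fun j _ => (Real.exp_pos _).le)]
  have : (s : ℝ) * Real.exp 1 ^ size z = ∑ _j : Fin s, Real.exp 1 ^ size z := by simp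
  rw [this]
  refine Finset.sum_le_sum fun j _ => ?_
  rw [← Real.exp_nat_mul, mul_one]
  refine Real.exp_le_exp.2 ?_
  have e : β * M.ratio j (fun k => (z.1 k : ℝ)) (fun k => (z.2 k : ℝ)) =
      ∑ i, (β * (M.Dpos j i / M.cap j) * z.1 i + β * (M.Dneg j i / M.cap j) * z.2 i) := by
    unfold Model.ratio
    rw [← Finset.sum_add_distrib, Finset.sum_div, Finset.mul_sum]
    exact Finset.sum_congr rfl fun i _ => by ring
  rw [e]
  unfold size
  push_cast
  refine Finset.sum_le_sum fun i _ => add_le_add ?_ ?_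
  · refine mul_le_of_le_one_left (Nat.cast_nonneg _) ?_
    exact (mul_div_le_of_abs_le hβ₀ (hcap j) (M.Dpos_le_abs j i) (hβ j i)).trans hε
  · refine mul_le_of_le_one_left (Nat.cast_nonneg _) ?_
    exact (mul_div_le_of_abs_le hβ₀ (hcap j) (M.Dneg_le_abs j i) (hβ j i)).trans hε

/-- The generator maps functions of exponential growth to functions of exponential growth. -/
lemma Model.exists_abs_generator_le (C : ℝ) {b : ℝ} (hb : 1 ≤ b) :
    ∃ C', ∀ f : State m → ℝ, (∀ z, |f z| ≤ C * b ^ size z) →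
      ∀ z, |M.generator β f z| ≤ C' * (2 * b) ^ size z := by
  refine ⟨∑ i, (|M.lam i| * (C * (b + 1)) + |M.mu i| * (2 * C) + |M.mu i| * (2 * C)),
    fun f hf z => ?_⟩
  have hC : 0 ≤ C := by
    have := (abs_nonneg _).trans (hf z)
    exact nonneg_of_mul_nonneg_left this (by positivity)
  have hle : ∀ w, size w ≤ size z → |f w| ≤ C * b ^ size z := fun w hw =>
    (hf w).trans (mul_le_mul_of_nonneg_left (pow_le_pow_right₀ hb hw) hC)
  -- The departure rates are linear in the size; doubling the base absorbs them.
  have h2 : (size z : ℝ) ≤ 2 ^ size z := by exact_mod_cast Nat.lt_two_pow_self.le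
  have h1 : (1 : ℝ) ≤ 2 ^ size z := one_le_pow₀ (by norm_num)
  have hbp : 0 < b ^ size z := by positivity
  have hdep : ∀ (n : ℕ) (r : ℝ) (w : State m), n ≤ size z → size w ≤ size z →
      |r * n * (f w - f z)| ≤ |r| * (2 * C) * (2 * b) ^ size z := by
    intro n r w hn hw
    rw [abs_mul, abs_mul, mul_assoc, mul_assoc, Nat.abs_cast]
    refine mul_le_mul_of_nonneg_left ?_ (abs_nonneg _)
    have h3 : |f w - f z| ≤ 2 * C * b ^ size z := by
      linarith [abs_sub (f w) (f z), hle w hw, hle z le_rfl]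
    have h4 : (n : ℝ) ≤ 2 ^ size z := le_trans (by exact_mod_cast hn) h2
    calc (n : ℝ) * |f w - f z| ≤ 2 ^ size z * (2 * C * b ^ size z) :=
          mul_le_mul h4 h3 (abs_nonneg _) (by positivity)
      _ = _ := by rw [mul_pow]; ring
  unfold Model.generator
  rw [Finset.sum_mul]
  refine (Finset.abs_sum_le_sum_abs _ _).trans (Finset.sum_le_sum fun i _ => ?_)
  have hi : z.1 i + z.2 i ≤ size z :=
    Finset.single_le_sum (f := fun k => z.1 k + z.2 k) (fun _ _ => Nat.zero_le _)
      (Finset.mem_univ i)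
  have hX := hdep (z.1 i) (M.mu i) (departX i z) (by omega) (size_departX_le i z)
  have hY := hdep (z.2 i) (M.mu i) (departY i z) (by omega) (size_departY_le i z)
  have hA : |M.lam i * (f (M.arrive β i z) - f z)| ≤
      |M.lam i| * (C * (b + 1)) * (2 * b) ^ size z := by
    rw [abs_mul, mul_assoc]
    refine mul_le_mul_of_nonneg_left ?_ (abs_nonneg _)
    have h3 := hf (M.arrive β i z)
    rw [size_arrive, pow_succ] at h3
    have h4 : |f (M.arrive β i z) - f z| ≤ C * (b + 1) * b ^ size z := by
      linarith [abs_sub (f (M.arrive β i z)) (f z), hle z le_rfl]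
    refine h4.trans ?_
    rw [mul_pow]
    refine mul_le_mul_of_nonneg_left ?_ (by positivity)
    exact le_mul_of_one_le_left hbp.le h1
  refine (abs_add_le _ _).trans ?_
  have := abs_add_le (M.lam i * (f (M.arrive β i z) - f z))
    (M.mu i * (z.1 i : ℝ) * (f (departX i z) - f z))
  linarith

/-- The drift of truncated exponentials is bounded above, uniformly in the truncation level. -/
lemma Model.exists_generator_pow_le [NeZero m] (hlam : ∀ i, 0 < M.lam i) (hmu : ∀ i, 0 < M.mu i)
    {b : ℝ} (hb : 1 < b) :
    ∃ C, 0 ≤ C ∧ ∀ (N : ℕ) (z : State m),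
      M.generator β (fun w => b ^ min (size w) N - b ^ N) z ≤ C := by
  have hb0 : 0 < b := by linarith
  have hmin := M.muMin_pos hmu
  set Λ := ∑ i, M.lam i with hΛ
  have hΛ0 : 0 ≤ Λ := Finset.sum_nonneg fun i _ => (hlam i).le
  -- From size `Λ b / μ_min` on, departures outweigh arrivals: `Λ (b - 1) ≤ (1 - b⁻¹) μ_min n`.
  obtain ⟨n₀, hn₀⟩ := exists_nat_ge (Λ * b / M.muMin)
  refine ⟨b ^ n₀ * (Λ * (b - 1)), mul_nonneg (by positivity) (mul_nonneg hΛ0 (by linarith)),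
    fun N z => ?_⟩
  have hmono : ∀ k l : ℕ, k ≤ l → b ^ k ≤ b ^ l := fun k l h => pow_le_pow_right₀ hb.le h
  have hC0 : 0 ≤ b ^ n₀ * (Λ * (b - 1)) :=
    mul_nonneg (by positivity) (mul_nonneg hΛ0 (by linarith))
  rcases le_or_gt N (size z) with hN | hN
  -- At or above the truncation level the function is at its maximum, so no jump increases it.
  · refine le_trans ?_ hC0
    unfold Model.generator
    refine Finset.sum_nonpos fun i _ => ?_
    have hw : ∀ w : State m, b ^ min (size w) N - b ^ N - (b ^ min (size z) N - b ^ N) ≤ 0 := by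
      intro w
      rw [min_eq_right hN]
      linarith [hmono _ _ (min_le_right (size w) N)]
    have e1 := mul_nonpos_of_nonneg_of_nonpos (hlam i).le (hw (M.arrive β i z))
    have e2 := mul_nonpos_of_nonneg_of_nonpos
      (mul_nonneg (hmu i).le (Nat.cast_nonneg (z.1 i))) (hw (departX i z))
    have e3 := mul_nonpos_of_nonneg_of_nonpos
      (mul_nonneg (hmu i).le (Nat.cast_nonneg (z.2 i))) (hw (departY i z))
    linarith
  · set n := size z with hn
    have hpn : 0 < b ^ n := by positivity
    have hk : ∀ (q : ℕ) (w : State m), (0 < q → size w + 1 = n) →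
        (q : ℝ) * (b ^ min (size w) N - b ^ N - (b ^ min n N - b ^ N)) =
          -(q * (b ^ n * (1 - b⁻¹))) := by
      intro q w hw
      rcases Nat.eq_zero_or_pos q with h | h
      · simp [h]
      · have := hw h
        rw [min_eq_left hN.le, min_eq_left (by omega), ← this, pow_succ]
        field_simp
        ring
    have hterm : M.generator β (fun w => b ^ min (size w) N - b ^ N) z =
        b ^ n * (∑ i, (M.lam i * (b - 1) - (1 - b⁻¹) * (M.mu i * (z.1 i + z.2 i)))) := by
      unfold Model.generator
      rw [Finset.mul_sum]
      refine Finset.sum_congr rfl fun i _ => ?_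
      rw [mul_assoc (M.mu i), mul_assoc (M.mu i), hk _ (departX i z) size_departX_of_pos,
        hk _ (departY i z) size_departY_of_pos]
      beta_reduce
      rw [size_arrive, ← hn, min_eq_left hN.le,
        min_eq_left (by omega), pow_succ]
      ring
    rw [hterm, Finset.sum_sub_distrib, ← Finset.sum_mul, ← Finset.mul_sum, ← hΛ]
    have hib : 0 < 1 - b⁻¹ := by
      have := inv_lt_one_of_one_lt₀ hb
      linarith
    have hS : M.muMin * n ≤ ∑ i, M.mu i * ((z.1 i : ℝ) + z.2 i) := by
      rw [hn, size]
      push_cast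
      rw [Finset.mul_sum]
      exact Finset.sum_le_sum fun i _ => mul_le_mul_of_nonneg_right (M.muMin_le i) (by positivity)
    have hS0 : 0 ≤ ∑ i, M.mu i * ((z.1 i : ℝ) + z.2 i) :=
      Finset.sum_nonneg fun i _ => mul_nonneg (hmu i).le (by positivity)
    rcases le_or_gt n₀ n with h | h
    · refine le_trans (mul_nonpos_of_nonneg_of_nonpos hpn.le ?_) hC0
      have h5 : Λ * b ≤ M.muMin * n := by
        rw [mul_comm M.muMin, ← div_le_iff₀ hmin]
        exact hn₀.trans (by exact_mod_cast h)
      have h6 : Λ * (b - 1) = (1 - b⁻¹) * (Λ * b) := by field_simp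
      rw [h6]
      have := mul_le_mul_of_nonneg_left (h5.trans hS) hib.le
      linarith
    · calc b ^ n * (Λ * (b - 1) - (1 - b⁻¹) * ∑ i, M.mu i * ((z.1 i : ℝ) + z.2 i))
          ≤ b ^ n * (Λ * (b - 1)) :=
            mul_le_mul_of_nonneg_left (by linarith [mul_nonneg hib.le hS0]) hpn.le
        _ ≤ _ := mul_le_mul_of_nonneg_right (hmono _ _ h.le) (mul_nonneg hΛ0 (by linarith))

lemma Model.generator_finite_support {f : State m → ℝ} (hf : (Function.support f).Finite) :
    ∃ C, ∀ z, |M.generator β f z| ≤ C := by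
  obtain ⟨N, hN⟩ : ∃ N, ∀ z, N ≤ size z → f z = 0 := by
    obtain ⟨N, hN⟩ := (hf.image size).bddAbove
    refine ⟨N + 1, fun z hz => ?_⟩
    by_contra h
    have := hN (Set.mem_image_of_mem size (Function.mem_support.2 h))
    omega
  -- A departure lowers the size by one, so the generator is only sure to vanish from size `N + 1`
  -- on.
  have hfin := finite_size_lt (m := m) (N + 1)
  obtain ⟨C, hC⟩ := (hfin.image (fun z => |M.generator β f z|)).bddAbove
  refine ⟨max C 0, fun z => ?_⟩
  by_cases hz : size z < N + 1
  · exact le_max_of_le_left (hC (Set.mem_image_of_mem _ hz))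
  · refine le_max_of_le_right ?_
    have hz' : N + 1 ≤ size z := not_lt.1 hz
    have : M.generator β f z = 0 := by
      unfold Model.generator
      refine Finset.sum_eq_zero fun i _ => ?_
      have hX : (z.1 i : ℝ) * (f (departX i z) - f z) = 0 := by
        rcases Nat.eq_zero_or_pos (z.1 i) with h | h
        · simp [h]
        · rw [hN z (by omega), hN _ (by have := size_departX_of_pos h; omega)]; simp
      have hY : (z.2 i : ℝ) * (f (departY i z) - f z) = 0 := by
        rcases Nat.eq_zero_or_pos (z.2 i) with h | h
        · simp [h]
        · rw [hN z (by omega), hN _ (by have := size_departY_of_pos h; omega)]; simp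
      rw [mul_assoc, mul_assoc, hX, hY, hN z (by omega), hN _ (by rw [size_arrive]; omega)]
      simp
    simp [this]

end drift

/-! ### Exponential growth and approximation of times from the right -/

/-- Functions of the state that grow at most exponentially in the number of requests. -/
def ExpGrowth (f : State m → ℝ) : Prop :=
  ∃ C b : ℝ, 1 < b ∧ ∀ z, |f z| ≤ C * b ^ size z

lemma ExpGrowth.generator {f : State m → ℝ} (hf : ExpGrowth f) (M : Model m s) (β : ℝ) :
    ExpGrowth (M.generator β f) := by
  obtain ⟨C, b, hb, h⟩ := hf
  obtain ⟨C', hC'⟩ := M.exists_abs_generator_le β C hb.le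
  exact ⟨C', 2 * b, by linarith, hC' f h⟩

lemma ExpGrowth.neg {f : State m → ℝ} (hf : ExpGrowth f) : ExpGrowth (fun z => -f z) := by
  obtain ⟨C, b, hb, h⟩ := hf
  exact ⟨C, b, hb, fun z => by rw [abs_neg]; exact h z⟩

lemma Model.generator_neg (M : Model m s) (β : ℝ) (f : State m → ℝ) (z : State m) :
    M.generator β (fun w => -f w) z = -M.generator β f z := by
  unfold Model.generator
  rw [← Finset.sum_neg_distrib]
  exact Finset.sum_congr rfl fun i _ => by ring

lemma expGrowth_classCount (i : Fin m) : ExpGrowth (classCount i) := by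
  refine ⟨1, 2, by norm_num, fun z => ?_⟩
  have h2 : (size z : ℝ) ≤ 2 ^ size z := by exact_mod_cast Nat.lt_two_pow_self.le
  have h0 : 0 ≤ classCount i z := by unfold classCount; positivity
  rw [abs_of_nonneg h0, one_mul]
  exact (classCount_le_size i z).trans h2

/-- Points of a grid of mesh `1 / (n + 1)` approximating `u` from the right. -/
noncomputable def gridAbove (n : ℕ) (u : ℝ≥0) : ℝ≥0 :=
  ((⌊u * (n + 1)⌋₊ + 1 : ℕ) : ℝ≥0) / (n + 1)

lemma tendsto_gridAbove (u : ℝ≥0) : Tendsto (fun n => gridAbove n u) atTop (𝓝[≥] u) := by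
  have hpos : ∀ n : ℕ, (0 : ℝ≥0) < n + 1 := fun n => by positivity
  have hle : ∀ n, u ≤ gridAbove n u := fun n => by
    rw [gridAbove, le_div_iff₀ (hpos n)]
    push_cast
    exact (Nat.lt_floor_add_one _).le
  have hge : ∀ n : ℕ, gridAbove n u ≤ u + 1 / (n + 1) := fun n => by
    rw [gridAbove, div_le_iff₀ (hpos n), add_mul, one_div_mul_cancel (hpos n).ne']
    push_cast
    gcongr
    exact Nat.floor_le (zero_le)
  refine tendsto_nhdsWithin_iff.2 ⟨?_, Eventually.of_forall hle⟩
  refine tendsto_of_tendsto_of_tendsto_of_le_of_le tendsto_const_nhds ?_ hle hge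
  have : Tendsto (fun n : ℕ => (1 : ℝ≥0) / (n + 1)) atTop (𝓝 0) :=
    tendsto_one_div_add_atTop_nhds_zero_nat
  simpa using this.const_add u

/-! ### Moments, Dynkin's formula and a Gronwall bound -/

namespace IsPenaltyProcess

variable {M : Model m s} {β : ℝ} {y₀ : Fin m → ℕ} {Ω : Type*} [mΩ : MeasurableSpace Ω]
  {P : Measure Ω} {ℱ : Filtration ℝ≥0 mΩ} {X : ℝ≥0 → Ω → State m}

lemma measurable_comp (hX : IsPenaltyProcess M β y₀ P ℱ X) (f : State m → ℝ) (t : ℝ≥0) :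
    Measurable fun ω => f (X t ω) :=
  (Measurable.of_discrete (f := f)).comp ((hX.adapted t).mono (ℱ.le t) le_rfl)

/-- Sampling at the next grid point gives a jointly measurable process, as only countably many times
occur. By right continuity it eventually equals the original at each point. Fubini's theorem in
Dynkin's formula needs this. -/
lemma measurable_uncurry_comp (hX : IsPenaltyProcess M β y₀ P ℱ X) (f : State m → ℝ) :
    Measurable fun q : ℝ × Ω => f (X q.1.toNNReal q.2) := by
  refine measurable_of_tendsto_metrizable
    (f := fun n (q : ℝ × Ω) => f (X (gridAbove n q.1.toNNReal) q.2)) (fun n => ?_) ?_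
  · have h1 : Measurable fun r : ℕ × Ω => f (X (((r.1 + 1 : ℕ) : ℝ≥0) / (n + 1)) r.2) :=
      measurable_from_prod_countable_right fun k => hX.measurable_comp f (((k + 1 : ℕ) : ℝ≥0) / (n + 1))
    have h2 : Measurable fun q : ℝ × Ω => (⌊q.1.toNNReal * ((n : ℝ≥0) + 1)⌋₊, q.2) :=
      (Nat.measurable_floor.comp ((measurable_real_toNNReal.comp measurable_fst).mul_const _)).prodMk
        measurable_snd
    exact h1.comp h2
  · refine tendsto_pi_nhds.2 fun q => ?_
    refine tendsto_const_nhds.congr' ?_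
    filter_upwards [(tendsto_gridAbove q.1.toNNReal).eventually
      (hX.right_continuous q.2 q.1.toNNReal)] with n hn
    rw [hn]

variable [IsProbabilityMeasure P]

lemma integral_comp_zero (hX : IsPenaltyProcess M β y₀ P ℱ X) (f : State m → ℝ) :
    ∫ ω, f (X 0 ω) ∂P = f (0, y₀) := by
  have : (fun ω => f (X 0 ω)) =ᵐ[P] fun _ => f (0, y₀) := by
    filter_upwards [hX.initial] with ω hω
    rw [hω]
  rw [integral_congr_ae this]; simp

/-- Dynkin's formula for finitely supported functions. -/
lemma integral_eq_of_finite_support (hX : IsPenaltyProcess M β y₀ P ℱ X) {f : State m → ℝ}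
    (hf : (Function.support f).Finite) {t : ℝ} (ht : 0 ≤ t) :
    ∫ ω, f (X t.toNNReal ω) ∂P =
      f (0, y₀) + ∫ u in (0 : ℝ)..t, ∫ ω, M.generator β f (X u.toNNReal ω) ∂P := by
  have hmart := hX.martingale f hf
  obtain ⟨C, hC⟩ := M.generator_finite_support β hf
  have hprod : Integrable (Function.uncurry fun (u : ℝ) ω => M.generator β f (X u.toNNReal ω))
      ((volume.restrict (Set.Ioc 0 t)).prod P) :=
    Integrable.of_bound (hX.measurable_uncurry_comp (M.generator β f)).aestronglyMeasurable C
      (Eventually.of_forall fun q => hC _)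
  have hint : Integrable (fun ω => f (X t.toNNReal ω)) P := by
    obtain ⟨K, hK⟩ := (hf.image (fun z => |f z|)).bddAbove
    refine Integrable.of_bound (hX.measurable_comp f _).aestronglyMeasurable (max K 0)
      (Eventually.of_forall fun ω => ?_)
    by_cases h : f (X t.toNNReal ω) = 0
    · rw [h]; simp
    · exact le_max_of_le_left (hK (Set.mem_image_of_mem _ (Function.mem_support.2 h)))
  have hint2 : Integrable (fun ω => ∫ u in (0 : ℝ)..t, M.generator β f (X u.toNNReal ω)) P := by
    simp only [intervalIntegral.integral_of_le ht]
    exact hprod.integral_prod_right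
  have h1 := hmart.setIntegral_eq (zero_le : (0 : ℝ≥0) ≤ t.toNNReal) MeasurableSet.univ
  simp only [Measure.restrict_univ, Real.coe_toNNReal t ht, NNReal.coe_zero,
    intervalIntegral.integral_same, sub_zero] at h1
  rw [hX.integral_comp_zero, integral_sub hint hint2] at h1
  rw [h1, intervalIntegral.integral_of_le ht, integral_integral_swap hprod]
  simp only [intervalIntegral.integral_of_le ht]
  ring

/-- Exponential moments of the number of requests are finite and grow at most linearly. -/
lemma exists_integral_pow_le [NeZero m] (hX : IsPenaltyProcess M β y₀ P ℱ X)
    (hlam : ∀ i, 0 < M.lam i) (hmu : ∀ i, 0 < M.mu i) {b : ℝ} (hb : 1 < b) :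
    ∃ A B : ℝ, 0 ≤ A ∧ 0 ≤ B ∧ ∀ t : ℝ≥0, Integrable (fun ω => b ^ size (X t ω)) P ∧
      ∫ ω, b ^ size (X t ω) ∂P ≤ A + B * t := by
  obtain ⟨C, hC0, hC⟩ := M.exists_generator_pow_le β hlam hmu hb
  refine ⟨b ^ size ((0, y₀) : State m), C, by positivity, hC0, fun t => ?_⟩
  set R := b ^ size ((0, y₀) : State m) + C * t with hR
  have hR0 : 0 ≤ R := by positivity
  have hmeas : ∀ N : ℕ, Measurable fun ω => b ^ min (size (X t ω)) N := fun N =>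
    hX.measurable_comp (fun z => b ^ min (size z) N) t
  have hintN : ∀ N : ℕ, Integrable (fun ω => b ^ min (size (X t ω)) N) P := fun N =>
    Integrable.of_bound (hmeas N).aestronglyMeasurable (b ^ N) <| Eventually.of_forall fun ω => by
      rw [Real.norm_of_nonneg (by positivity)]
      exact pow_le_pow_right₀ hb.le (min_le_right _ _)
  have hN : ∀ N : ℕ, ∫ ω, b ^ min (size (X t ω)) N ∂P ≤ R := by
    intro N
    -- Subtracting the constant `b ^ N` makes the truncation finitely supported without changing its
    -- generator.
    have hfin : (Function.support fun z : State m => b ^ min (size z) N - b ^ N).Finite := by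
      refine (finite_size_lt N).subset fun z hz => ?_
      by_contra h
      exact hz (by simp only; rw [min_eq_right (not_lt.1 h), sub_self])
    have h1 := hX.integral_eq_of_finite_support hfin t.coe_nonneg
    have h2 : ∫ u in (0 : ℝ)..t, ∫ ω,
        M.generator β (fun z => b ^ min (size z) N - b ^ N) (X u.toNNReal ω) ∂P ≤ C * t := by
      obtain ⟨K, hK⟩ := M.generator_finite_support β hfin
      have hbd : ∀ u : ℝ, Integrable (fun ω =>
          M.generator β (fun z => b ^ min (size z) N - b ^ N) (X u.toNNReal ω)) P := fun u =>
        Integrable.of_bound (hX.measurable_comp _ _).aestronglyMeasurable K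
          (Eventually.of_forall fun ω => hK _)
      calc _ ≤ ∫ _u in (0 : ℝ)..t, C := by
            refine intervalIntegral.integral_mono_on t.coe_nonneg ?_
              intervalIntegrable_const fun u _ => ?_
            · refine (intervalIntegrable_const (c := K)).mono_fun
                ((hX.measurable_uncurry_comp
                  _).stronglyMeasurable.integral_prod_right').aestronglyMeasurable
                (Eventually.of_forall fun u => ?_)
              refine (norm_integral_le_of_norm_le_const (C := K)
                (Eventually.of_forall fun ω => hK _)).trans ?_
              simp [le_abs_self]
            · have := integral_mono (hbd u) (integrable_const C) fun ω => hC N _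
              simpa using this
        _ = C * t := by simp [mul_comm]
    rw [Real.toNNReal_coe, integral_sub (hintN N) (integrable_const _)] at h1
    simp only [integral_const, probReal_univ, one_smul] at h1
    have h3 : b ^ min (size ((0, y₀) : State m)) N ≤ b ^ size ((0, y₀) : State m) :=
      pow_le_pow_right₀ hb.le (min_le_left _ _)
    linarith
  have hm : Measurable fun ω => b ^ size (X t ω) := hX.measurable_comp (fun z => b ^ size z) t
  -- Fatou's lemma removes the truncation, since `R` does not depend on `N`.
  have hL : ∫⁻ ω, ENNReal.ofReal (b ^ size (X t ω)) ∂P ≤ ENNReal.ofReal R := by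
    have hlim : ∀ ω, liminf (fun N : ℕ => ENNReal.ofReal (b ^ min (size (X t ω)) N)) atTop =
        ENNReal.ofReal (b ^ size (X t ω)) := by
      intro ω
      refine Tendsto.liminf_eq (tendsto_const_nhds.congr' ?_)
      filter_upwards [eventually_ge_atTop (size (X t ω))] with N hN
      rw [min_eq_left hN]
    calc ∫⁻ ω, ENNReal.ofReal (b ^ size (X t ω)) ∂P
        = ∫⁻ ω, liminf (fun N : ℕ => ENNReal.ofReal (b ^ min (size (X t ω)) N)) atTop ∂P := by
          simp only [hlim]
      _ ≤ liminf (fun N : ℕ => ∫⁻ ω, ENNReal.ofReal (b ^ min (size (X t ω)) N) ∂P) atTop :=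
          lintegral_liminf_le fun N => (hmeas N).ennreal_ofReal
      _ ≤ ENNReal.ofReal R := by
          refine liminf_le_of_frequently_le' (Frequently.of_forall fun N => ?_)
          rw [← ofReal_integral_eq_lintegral_ofReal (hintN N)
            (Eventually.of_forall fun ω => by positivity)]
          exact ENNReal.ofReal_le_ofReal (hN N)
  have hi : Integrable (fun ω => b ^ size (X t ω)) P := by
    refine ⟨hm.aestronglyMeasurable, ?_⟩
    rw [hasFiniteIntegral_iff_ofReal (Eventually.of_forall fun ω => by positivity)]
    exact hL.trans_lt ENNReal.ofReal_lt_top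
  refine ⟨hi, ?_⟩
  rw [← ofReal_integral_eq_lintegral_ofReal hi (Eventually.of_forall fun ω => by positivity)] at hL
  exact (ENNReal.ofReal_le_ofReal_iff hR0).1 hL

section growth

variable [NeZero m] (hX : IsPenaltyProcess M β y₀ P ℱ X)
  (hlam : ∀ i, 0 < M.lam i) (hmu : ∀ i, 0 < M.mu i)

include hX hlam hmu

lemma integrable_comp {f : State m → ℝ} (hf : ExpGrowth f) (t : ℝ≥0) :
    Integrable (fun ω => f (X t ω)) P := by
  obtain ⟨C, b, hb, h⟩ := hf
  obtain ⟨A, B, -, -, hAB⟩ := hX.exists_integral_pow_le hlam hmu hb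
  exact ((hAB t).1.const_mul C).mono' (hX.measurable_comp f t).aestronglyMeasurable
    (Eventually.of_forall fun ω => h _)

/-- The bound is uniform over all `f` with the same growth, so it dominates the time integrands of
all truncations at once. -/
lemma exists_norm_integral_le (C : ℝ) {b : ℝ} (hb : 1 < b) :
    ∃ A B : ℝ, ∀ f : State m → ℝ, (∀ z, |f z| ≤ C * b ^ size z) → ∀ u : ℝ,
      ‖∫ ω, f (X u.toNNReal ω) ∂P‖ ≤ A + B * |u| := by
  obtain ⟨A, B, hA, hB, hAB⟩ := hX.exists_integral_pow_le hlam hmu hb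
  refine ⟨C * A, C * B, fun f hf u => ?_⟩
  have hC : 0 ≤ C := nonneg_of_mul_nonneg_left
    ((abs_nonneg _).trans (hf (0, 0))) (by positivity)
  obtain ⟨hi, hle⟩ := hAB u.toNNReal
  calc ‖∫ ω, f (X u.toNNReal ω) ∂P‖ ≤ ∫ ω, C * b ^ size (X u.toNNReal ω) ∂P :=
        norm_integral_le_of_norm_le (hi.const_mul C) (Eventually.of_forall fun ω => hf _)
    _ = C * ∫ ω, b ^ size (X u.toNNReal ω) ∂P := integral_const_mul _ _
    _ ≤ C * (A + B * |u|) := by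
        refine mul_le_mul_of_nonneg_left (hle.trans ?_) hC
        refine add_le_add le_rfl (mul_le_mul_of_nonneg_left ?_ hB)
        rw [Real.coe_toNNReal']
        exact max_le (le_abs_self u) (abs_nonneg u)
    _ = _ := by ring

lemma intervalIntegrable_integral {f : State m → ℝ} (hf : ExpGrowth f) (a b : ℝ) :
    IntervalIntegrable (fun u : ℝ => ∫ ω, f (X u.toNNReal ω) ∂P) volume a b := by
  obtain ⟨C, c, hc, h⟩ := hf
  obtain ⟨A, B, hAB⟩ := hX.exists_norm_integral_le hlam hmu C hc
  have hcont : Continuous fun u : ℝ => A + B * |u| := by fun_prop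
  refine (hcont.intervalIntegrable a b).mono_fun
    ((hX.measurable_uncurry_comp f).stronglyMeasurable.integral_prod_right').aestronglyMeasurable
    (Eventually.of_forall fun u => ?_)
  exact (hAB f h u).trans (le_abs_self _)

/-- Dynkin's formula for functions of exponential growth. -/
lemma integral_eq_of_expGrowth {f : State m → ℝ} (hf : ExpGrowth f) {t : ℝ} (ht : 0 ≤ t) :
    ∫ ω, f (X t.toNNReal ω) ∂P =
      f (0, y₀) + ∫ u in (0 : ℝ)..t, ∫ ω, M.generator β f (X u.toNNReal ω) ∂P := by
  have hf' := hf
  obtain ⟨C, b, hb, h⟩ := hf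
  obtain ⟨C', hC'⟩ := M.exists_abs_generator_le β C hb.le
  set g : ℕ → State m → ℝ := fun N z => if size z < N then f z else 0 with hg
  have hgle : ∀ N z, |g N z| ≤ C * b ^ size z := by
    intro N z
    by_cases hz : size z < N
    · simpa [hg, hz] using h z
    · simpa [hg, hz] using (abs_nonneg _).trans (h z)
  have hgfin : ∀ N, (Function.support (g N)).Finite := fun N =>
    (finite_size_lt N).subset fun z hz => by
      by_contra hlt
      exact hz (if_neg hlt)
  have hgf : ∀ N z, size z < N → g N z = f z := fun N z hz => if_pos hz
  -- The margin of one is needed because an arrival raises the size by one.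
  have hGf : ∀ N z, size z + 1 < N → M.generator β (g N) z = M.generator β f z := by
    intro N z hz
    unfold Model.generator
    refine Finset.sum_congr rfl fun i _ => ?_
    rw [hgf N z (by omega), hgf N _ (by rw [size_arrive]; omega),
      hgf N _ (by have := size_departX_le i z; omega),
      hgf N _ (by have := size_departY_le i z; omega)]
  have hDf : ExpGrowth fun z : State m => C * b ^ size z := by
    refine ⟨C, b, hb, fun z => ?_⟩
    rw [abs_of_nonneg ((abs_nonneg _).trans (h z))]
  have hDG : ExpGrowth fun z : State m => C' * (2 * b) ^ size z := by
    refine ⟨C', 2 * b, by linarith, fun z => ?_⟩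
    rw [abs_of_nonneg ((abs_nonneg _).trans (hC' f h z))]
  have hL : Tendsto (fun N => ∫ ω, g N (X t.toNNReal ω) ∂P) atTop
      (𝓝 (∫ ω, f (X t.toNNReal ω) ∂P)) := by
    refine tendsto_integral_of_dominated_convergence (fun ω => C * b ^ size (X t.toNNReal ω))
      (fun N => (hX.measurable_comp _ _).aestronglyMeasurable)
      (hX.integrable_comp hlam hmu hDf _)
      (fun N => Eventually.of_forall fun ω => hgle N _) (Eventually.of_forall fun ω => ?_)
    refine tendsto_const_nhds.congr' ?_
    filter_upwards [eventually_gt_atTop (size (X t.toNNReal ω))] with N hN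
    exact (hgf N _ hN).symm
  have hR : Tendsto (fun N => ∫ u in (0 : ℝ)..t, ∫ ω, M.generator β (g N) (X u.toNNReal ω) ∂P)
      atTop (𝓝 (∫ u in (0 : ℝ)..t, ∫ ω, M.generator β f (X u.toNNReal ω) ∂P)) := by
    obtain ⟨A, B, hAB⟩ := hX.exists_norm_integral_le hlam hmu C' (b := 2 * b) (by linarith)
    refine intervalIntegral.tendsto_integral_filter_of_dominated_convergence
      (fun u => A + B * |u|) (Eventually.of_forall fun N => ?_) (Eventually.of_forall fun N =>
        Eventually.of_forall fun u _ => hAB _ (hC' _ (hgle N)) u)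
      ((by fun_prop : Continuous fun u : ℝ => A + B * |u|).intervalIntegrable _ _)
      (Eventually.of_forall fun u _ => ?_)
    · exact ((hX.measurable_uncurry_comp
        _).stronglyMeasurable.integral_prod_right').aestronglyMeasurable
    · refine tendsto_integral_of_dominated_convergence
        (fun ω => C' * (2 * b) ^ size (X u.toNNReal ω))
        (fun N => (hX.measurable_comp _ _).aestronglyMeasurable)
        (hX.integrable_comp hlam hmu hDG _)
        (fun N => Eventually.of_forall fun ω => hC' _ (hgle N) _) (Eventually.of_forall fun ω => ?_)
      refine tendsto_const_nhds.congr' ?_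
      filter_upwards [eventually_gt_atTop (size (X u.toNNReal ω) + 1)] with N hN
      exact (hGf N _ hN).symm
  have h0 : Tendsto (fun N => g N (0, y₀)) atTop (𝓝 (f (0, y₀))) := by
    refine tendsto_const_nhds.congr' ?_
    filter_upwards [eventually_gt_atTop (size ((0, y₀) : State m))] with N hN
    exact (hgf N _ hN).symm
  refine tendsto_nhds_unique hL ((h0.add hR).congr fun N => ?_)
  exact (hX.integral_eq_of_finite_support (hgfin N) ht).symm

/-- By Dynkin's formula the mean is the primitive of an interval integrable function; `max t 0`
accounts for `toNNReal` at negative times. -/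
lemma continuous_integral {f : State m → ℝ} (hf : ExpGrowth f) :
    Continuous fun t : ℝ => ∫ ω, f (X t.toNNReal ω) ∂P := by
  have h : (fun t : ℝ => ∫ ω, f (X t.toNNReal ω) ∂P) = fun t =>
      f (0, y₀) + ∫ u in (0 : ℝ)..(max t 0), ∫ ω, M.generator β f (X u.toNNReal ω) ∂P := by
    ext t
    rw [← hX.integral_eq_of_expGrowth hlam hmu hf (le_max_right t 0)]
    congr 3
    simp [Real.toNNReal]
  rw [h]
  exact continuous_const.add ((intervalIntegral.continuous_primitive
    (fun a b => hX.intervalIntegrable_integral hlam hmu (hf.generator M β) a b) 0).comp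
    (continuous_id.max continuous_const))

/-- A drift towards the level `A` at rate `c` bounds the mean. -/
lemma integral_le_of_generator_le {f : State m → ℝ} (hf : ExpGrowth f) {c A : ℝ}
    (hdrift : ∀ z, M.generator β f z ≤ c * (A - f z)) (t : ℝ≥0) :
    ∫ ω, f (X t ω) ∂P ≤ A + Real.exp (-(c * t)) * (f (0, y₀) - A) := by
  set w : ℝ → ℝ := fun u => ∫ ω, M.generator β f (X u.toNNReal ω) ∂P with hw
  have hwc : Continuous w := hX.continuous_integral hlam hmu (hf.generator M β)
  set F : ℝ → ℝ := fun t => f (0, y₀) + ∫ u in (0 : ℝ)..t, w u with hF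
  -- The generator of `f` again has exponential growth, so its mean `w` is continuous and the
  -- primitive is differentiable everywhere.
  have hFd : ∀ u, HasDerivAt F (w u) u := fun u =>
    (hwc.integral_hasStrictDerivAt 0 u).hasDerivAt.const_add _
  have hFv : ∀ u, 0 ≤ u → ∫ ω, f (X u.toNNReal ω) ∂P = F u := fun u hu =>
    hX.integral_eq_of_expGrowth hlam hmu hf hu
  have hwle : ∀ u, 0 ≤ u → w u ≤ c * (A - F u) := by
    intro u hu
    have hi := hX.integrable_comp hlam hmu hf u.toNNReal
    have h1 := integral_mono (hX.integrable_comp hlam hmu (hf.generator M β) u.toNNReal)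
      (((integrable_const A).sub hi).const_mul c) fun ω => hdrift _
    simp only [Pi.sub_apply] at h1
    rw [integral_const_mul, integral_sub (integrable_const A) hi, hFv u hu] at h1
    simpa using h1
  -- Integrating factor: the drift inequality makes `φ` nonincreasing on `[0, ∞)`.
  set φ : ℝ → ℝ := fun u => Real.exp (c * u) * (F u - A) with hφ
  have hφd : ∀ u, HasDerivAt φ
      (Real.exp (c * u) * (c * 1) * (F u - A) + Real.exp (c * u) * w u) u := fun u =>
    (((hasDerivAt_id u).const_mul c).exp).mul ((hFd u).sub_const A)
  have hanti : AntitoneOn φ (Set.Ici 0) := by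
    refine antitoneOn_of_deriv_nonpos (convex_Ici 0)
      (fun u _ => (hφd u).continuousAt.continuousWithinAt)
      (fun u _ => (hφd u).differentiableAt.differentiableWithinAt) fun u hu => ?_
    rw [interior_Ici] at hu
    rw [(hφd u).deriv]
    have := mul_le_mul_of_nonneg_left (hwle u (le_of_lt hu)) (Real.exp_pos (c * u)).le
    linarith
  have h1 := hanti (Set.mem_Ici.2 le_rfl) (Set.mem_Ici.2 t.coe_nonneg) t.coe_nonneg
  simp only [hφ, hF, mul_zero, Real.exp_zero, one_mul, intervalIntegral.integral_same,
    add_zero] at h1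
  have h2 := hFv t t.coe_nonneg
  rw [Real.toNNReal_coe] at h2
  rw [h2]
  have h3 := mul_le_mul_of_nonneg_left h1 (Real.exp_pos (-(c * t))).le
  rw [← mul_assoc, ← Real.exp_add, neg_add_cancel, Real.exp_zero, one_mul] at h3
  linarith

end growth

end IsPenaltyProcess

/-! ### From the penalty level to the ratios -/

lemma Model.ratio_smul (M : Model m s) (j : Fin s) (c : ℝ) (x y : Fin m → ℝ) :
    M.ratio j (c • x) (c • y) = c * M.ratio j x y := by
  unfold Model.ratio
  rw [← mul_div_assoc, mul_add, Finset.mul_sum, Finset.mul_sum]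
  simp only [Pi.smul_apply, smul_eq_mul, mul_left_comm c]

/-- Ratios are homogeneous, and each is at most `μ_min / μ_max` at `p`, which cancels the factor
`μ_max / μ_min` in the level. -/
lemma Model.penaltyLevel_le [NeZero m] (M : Model m s) (hmu : ∀ i, 0 < M.mu i) {β ε : ℝ}
    (hβ₀ : 0 < β) (hε₀ : 0 < ε) {p : (Fin m → ℝ) × (Fin m → ℝ)}
    (hrates : M.violation p ≤ M.muMin / M.muMax) :
    M.penaltyLevel β ε p ≤ s * Real.exp (β * (1 + 3 * ε)) := by
  have hmin := M.muMin_pos hmu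
  have hmax : 0 < M.muMax := (hmu 0).trans_le (M.le_muMax 0)
  have h : (s : ℝ) * Real.exp (β * (1 + 3 * ε)) =
      ∑ _j : Fin s, Real.exp (β * (1 + 3 * ε)) := by simp
  rw [h]
  unfold Model.penaltyLevel Model.penalty
  refine Finset.sum_le_sum fun j _ => Real.exp_le_exp.2 (mul_le_mul_of_nonneg_left ?_ hβ₀.le)
  rw [M.ratio_smul]
  have h1 : M.ratio j p.1 p.2 ≤ M.muMin / M.muMax :=
    (le_ciSup (f := fun j => M.ratio j p.1 p.2) (Set.finite_range _).bddAbove j).trans hrates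
  calc (1 + 3 * ε) * M.muMax / M.muMin * M.ratio j p.1 p.2
      ≤ (1 + 3 * ε) * M.muMax / M.muMin * (M.muMin / M.muMax) :=
        mul_le_mul_of_nonneg_left h1 (by positivity)
    _ = 1 + 3 * ε := by field_simp

/-- A bound on the mean of the penalty bounds the mean of each ratio, by Jensen's inequality. -/
lemma Model.integral_ratio_le [NeZero s] (M : Model m s) {β ε : ℝ} (hβ₀ : 0 < β)
    {Ω : Type*} [MeasurableSpace Ω] {P : Measure Ω} [IsProbabilityMeasure P] {Z : Ω → State m}
    (j : Fin s)
    (hr : Integrable (fun ω => M.ratio j (fun k => ((Z ω).1 k : ℝ)) fun k => ((Z ω).2 k : ℝ)) P)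
    (he : Integrable (fun ω => Real.exp
      (β * M.ratio j (fun k => ((Z ω).1 k : ℝ)) fun k => ((Z ω).2 k : ℝ))) P)
    (hΨ : Integrable (fun ω => M.statePenalty β (Z ω)) P)
    (h : ∫ ω, M.statePenalty β (Z ω) ∂P ≤ s * Real.exp (β * (1 + 3 * ε))) :
    ∫ ω, M.ratio j (fun k => ((Z ω).1 k : ℝ)) (fun k => ((Z ω).2 k : ℝ)) ∂P ≤
      1 + (Real.log s / β + 3 * ε) := by
  have hs : (0 : ℝ) < s := by exact_mod_cast Nat.pos_of_ne_zero (NeZero.ne s)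
  have h1 := convexOn_exp.map_integral_le Real.continuous_exp.continuousOn isClosed_univ
    (Eventually.of_forall fun ω => Set.mem_univ _) (hr.const_mul β) he
  have h2 := integral_mono he hΨ fun ω => Finset.single_le_sum
    (f := fun j => Real.exp (β * M.ratio j (fun k => ((Z ω).1 k : ℝ)) fun k => ((Z ω).2 k : ℝ)))
    (fun _ _ => (Real.exp_pos _).le) (Finset.mem_univ j)
  have h3 := (h1.trans h2).trans h
  rw [← Real.exp_log hs, ← Real.exp_add, Real.exp_le_exp, integral_const_mul] at h3
  have h4 : Real.log s = β * (Real.log s / β) := by field_simp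
  rw [h4, ← mul_add] at h3
  have h5 := le_of_mul_le_mul_left h3 hβ₀
  linarith

end PolytopicTarget

/-! ### The bound on the mean state -/

open PolytopicTarget

theorem theorem9 {m s : ℕ} [NeZero m] [NeZero s]
    (M : PolytopicTarget.Model m s)
    (hlam : ∀ i, 0 < M.lam i) (hmu : ∀ i, 0 < M.mu i) (hh : ∀ j, 0 ≤ M.h j)
    (hint : ∃ x ∈ M.targetSet, ∀ j, ∑ i, M.D j i * x i < M.h j)
    (ε β : ℝ) (hε₀ : 0 < ε) (hε : ε < 1 / 4)
    (hβ₀ : 0 < β) (hβ : ∀ j i, β * |M.D j i| ≤ ε * M.cap j)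
    (p : (Fin m → ℝ) × (Fin m → ℝ)) (hp : p ∈ M.liftedSet)
    (hmin : IsMinOn M.violation M.liftedSet p)
    (hrates : M.violation p ≤ M.muMin / M.muMax)
    (y₀ : Fin m → ℕ)
    (hinit : M.penalty β 0 (fun i => (y₀ i : ℝ)) ≤ M.penaltyLevel β ε p)
    {Ω : Type*} [mΩ : MeasurableSpace Ω] (P : Measure Ω) [IsProbabilityMeasure P]
    (ℱ : Filtration ℝ≥0 mΩ) (X : ℝ≥0 → Ω → PolytopicTarget.State m)
    (hX : PolytopicTarget.IsPenaltyProcess M β y₀ P ℱ X) (t : ℝ≥0) :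
    (∀ i, Integrable (fun ω => ((X t ω).1 i : ℝ)) P) ∧
    ∀ j, ∑ i, M.D j i * ∫ ω, ((X t ω).1 i : ℝ) ∂P ≤
      M.h j + (Real.log s / β + 3 * ε) * (M.h j + ∑ i, M.Dneg j i * M.load i)
        + ∑ i, M.Dneg j i * Real.exp (-(M.mu i * t)) * (M.load i - y₀ i) := by
  have hcap := M.cap_pos hint
  have hn : ∀ i, Integrable (fun ω => classCount i (X t ω)) P := fun i =>
    hX.integrable_comp hlam hmu (expGrowth_classCount i) t
  have hix : ∀ i, Integrable (fun ω => ((X t ω).1 i : ℝ)) P := fun i =>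
    (hn i).mono' (hX.measurable_comp (fun z => (z.1 i : ℝ)) t).aestronglyMeasurable
      (Eventually.of_forall fun ω => by simp [classCount])
  have hiy : ∀ i, Integrable (fun ω => ((X t ω).2 i : ℝ)) P := fun i =>
    (hn i).mono' (hX.measurable_comp (fun z => (z.2 i : ℝ)) t).aestronglyMeasurable
      (Eventually.of_forall fun ω => by simp [classCount])
  refine ⟨hix, fun j => ?_⟩
  have hΨg : ExpGrowth (M.statePenalty β) :=
    ⟨s, Real.exp 1, Real.one_lt_exp_iff.2 one_pos,
      M.abs_statePenalty_le β hβ₀ (by linarith) hcap hβ⟩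
  have hΨ := hX.integrable_comp hlam hmu hΨg t
  have hlevel : ∫ ω, M.statePenalty β (X t ω) ∂P ≤ s * Real.exp (β * (1 + 3 * ε)) := by
    have h1 := hX.integral_le_of_generator_le hlam hmu hΨg
      (M.generator_statePenalty_le β hlam hmu hβ₀ hε₀ hε hcap hβ hp) t
    have h0 : M.statePenalty β (0, y₀) ≤ M.penaltyLevel β ε p := by
      have hz : (fun k => (((0 : Fin m → ℕ) k : ℕ) : ℝ)) = 0 := by ext; simp
      simpa only [Model.statePenalty, hz] using hinit
    have h2 := mul_nonpos_of_nonneg_of_nonpos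
      (Real.exp_pos (-((1 - ε) * M.muMin * t))).le (sub_nonpos.2 h0)
    linarith [M.penaltyLevel_le hmu hβ₀ hε₀ hrates]
  have hsum : ∀ c : Fin m → ℝ, Integrable (fun ω => ∑ i, c i * ((X t ω).1 i : ℝ)) P := fun c =>
    integrable_finsetSum _ fun i _ => (hix i).const_mul _
  have hsum' : ∀ c : Fin m → ℝ, Integrable (fun ω => ∑ i, c i * ((X t ω).2 i : ℝ)) P := fun c =>
    integrable_finsetSum _ fun i _ => (hiy i).const_mul _
  have hratio := M.integral_ratio_le hβ₀ j
    (((hsum (M.Dpos j)).add (hsum' (M.Dneg j))).div_const (M.cap j))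
    (hΨ.mono' (hX.measurable_comp (fun z => Real.exp
      (β * M.ratio j (fun k => (z.1 k : ℝ)) fun k => (z.2 k : ℝ))) t).aestronglyMeasurable
      (Eventually.of_forall fun ω => by
        rw [Real.norm_of_nonneg (Real.exp_pos _).le]
        exact Finset.single_le_sum (f := fun j => Real.exp
          (β * M.ratio j (fun k => ((X t ω).1 k : ℝ)) fun k => ((X t ω).2 k : ℝ)))
          (fun _ _ => (Real.exp_pos _).le) (Finset.mem_univ j))) hΨ hlevel
  simp only [Model.ratio] at hratio
  rw [integral_div, integral_add (hsum (M.Dpos j)) (hsum' (M.Dneg j)),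
    integral_finsetSum _ fun i _ => (hix i).const_mul _,
    integral_finsetSum _ fun i _ => (hiy i).const_mul _, div_le_iff₀ (hcap j)] at hratio
  simp only [integral_const_mul] at hratio
  -- Only a lower bound on the mean total is needed, because `D⁻` is nonnegative; it comes from the
  -- drift bound for the negated count, where the drift is an equality.
  have hcount : ∀ i, M.load i - Real.exp (-(M.mu i * t)) * (M.load i - y₀ i) ≤
      ∫ ω, ((X t ω).1 i : ℝ) ∂P + ∫ ω, ((X t ω).2 i : ℝ) ∂P := by
    intro i
    have h1 := hX.integral_le_of_generator_le hlam hmu (expGrowth_classCount i).neg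
      (c := M.mu i) (A := -M.load i) (fun z => le_of_eq (by
        rw [M.generator_neg, M.generator_classCount]
        have : M.lam i = M.mu i * M.load i := by
          unfold Model.load; rw [mul_div_cancel₀ _ (hmu i).ne']
        rw [this]; ring)) t
    rw [integral_neg] at h1
    simp only [classCount] at h1
    rw [integral_add (hix i) (hiy i)] at h1
    simp only [Pi.zero_apply, Nat.cast_zero, zero_add] at h1
    linarith
  have hneg : ∑ i, M.Dneg j i * (M.load i - Real.exp (-(M.mu i * t)) * (M.load i - y₀ i)) ≤
      ∑ i, M.Dneg j i * (∫ ω, ((X t ω).1 i : ℝ) ∂P + ∫ ω, ((X t ω).2 i : ℝ) ∂P) :=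
    Finset.sum_le_sum fun i _ => mul_le_mul_of_nonneg_left (hcount i) (M.Dneg_nonneg j i)
  have hD : ∑ i, M.D j i * ∫ ω, ((X t ω).1 i : ℝ) ∂P =
      ∑ i, M.Dpos j i * ∫ ω, ((X t ω).1 i : ℝ) ∂P -
        ∑ i, M.Dneg j i * ∫ ω, ((X t ω).1 i : ℝ) ∂P := by
    rw [← Finset.sum_sub_distrib]
    exact Finset.sum_congr rfl fun i _ => by rw [← M.Dpos_sub_Dneg j i]; ring
  simp only [mul_sub, mul_add, Finset.sum_sub_distrib, Finset.sum_add_distrib, mul_assoc]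
    at hneg ⊢
  unfold Model.cap at hratio
  rw [hD]
  linarith
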